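/- Let $q$ be a prime power and let $U=U_n(q)$ be the group of upper unitriangular $n\times n$ matrices over $\mathbb F_q$. A positive root $\alpha$ is a position $(i,j)$ with $1\le i<j\le n$ (standing for the vector $e_i-e_j$; $i$ is its row, $j$ its column), with root subgroup $X_\alpha=\{x_\alpha(d)=I+d\,e_{i,j}: d\in\mathbb F_q\}\le U$; the set of positive roots is $\Sigma^+$. The arm of $\alpha=(i,j)$ is $\mathrm{arm}(\alpha)=\{(i,k): i<k<j\}$, and $V_\alpha=\langle X_\beta:\beta\in\Sigma^+\setminus \mathrm{arm}(\alpha)\rangle$. Fix a nontrivial linear character $\varphi:(\mathbb F_q,+)\to\mathbb C^\times$. For $s\in\mathbb F_q^\times$ let $\lambda_{\alpha,s}$ be the linear character of $V_\alpha$ with $\lambda_{\alpha,s}(x_\alpha(d))=\varphi(ds)$ for all $d\in\mathbb F_q$ and which is trivial on every other root subgroup $X_\beta\subseteq V_\alpha$, $\beta\ne\alpha$. Let $D\subseteq\Sigma^+$ be a basic set, that is, a nonempty set of positive roots, no two of which are on the same row or on the same column, and let $\phi=(\lambda_{\alpha,s_\alpha})_{\alpha\in D}$ with $s_\alpha\in\mathbb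 F_q^\times$ for every $\alpha\in D$. The associated supercharacter of $U$ is $\xi_{D,\phi}=\bigotimes_{\alpha\in D}(\lambda_{\alpha,s_\alpha})^U$, a superscript denoting induction of characters. Put $V_D=\bigcap_{\alpha\in D}V_\alpha$ and $\lambda_D=\bigotimes_{\alpha\in D}\lambda_{\alpha,s_\alpha}|_{V_D}$. Let $\Gamma_D$ be the set of positive roots $\gamma$ for which there are $\tau,\sigma\in D$ such that $\sigma$ lies strictly to the right of $\tau$ and strictly below $\tau$, $\gamma$ is on the row of $\tau$, and $\gamma+\sigma\in\Sigma^+$. Put $R_D=\langle X_\gamma:\gamma\in\Gamma_D\rangle$. For $H\le G$ finite and $\xi\in\mathrm{Irr}(H)$ let $\mathrm{Irr}(G,\xi)$ be the set of irreducible complex characters $\chi$ of $G$ with $(\chi,\xi^G)\ne0$, and let $\mathrm{Irr}(\xi_{D,\phi})$ be the set of irreducible constituents of $\xi_{D,\phi}$. Then: (i) $\xi_{D,\phi}={\lambda_D}^U=\bigl({\lambda_D}^{\langle V_D,R_D\rangle}\bigr)^U$. (ii) For each $\chi\in \mathrm{Irr}(\langle V_D,R_D\rangle,\lambda_D)$,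 the induced character $\chi^U$ is irreducible and belongs to $\mathrm{Irr}(\xi_{D,\phi})$. (iii) If $\chi_1\ne\chi_2$ are in $\mathrm{Irr}(\langle V_D,R_D\rangle,\lambda_D)$, then ${\chi_1}^U\ne{\chi_2}^U$. -/

import Mathlib

noncomputable section

/-! ### Characters of finite groups -/

namespace SuperChar

/-- `Irr(G)`: the set of characters of the irreducible finite-dimensional complex representations
of `G`. -/
def Irr (G : Type*) [Group G] : Set (G → ℂ) :=
  {χ | ∃ (V : Type) (_ : AddCommGroup V) (_ : Module ℂ V) (_ : FiniteDimensional ℂ V)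
    (ρ : Representation ℂ G V), ρ.IsIrreducible ∧ ρ.character = χ}

/-- The inner product `(χ, ψ) = |G|⁻¹ ∑_g χ(g) conj(ψ(g))` of complex functions on a finite
group. -/
def charInner {G : Type*} [Group G] [Finite G] (χ ψ : G → ℂ) : ℂ :=
  (Nat.card G : ℂ)⁻¹ * ∑ᶠ g : G, χ g * starRingEnd ℂ (ψ g)

/-- The induced class function, for an embedding `f : H →* G` of finite groups:
`χ^G(g) = |H|⁻¹ ∑_{x ∈ G} χ°(x⁻¹ g x)`, where `χ°` is `χ` on (the image of) `H` and `0` off it. -/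
def induced {H G : Type*} [Group H] [Group G] [Finite H] [Finite G] (f : H →* G) (χ : H → ℂ) :
    G → ℂ :=
  fun g => (Nat.card H : ℂ)⁻¹ * ∑ᶠ (x : G) (h : H) (_ : f h = x⁻¹ * g * x), χ h

/-- The set of irreducible constituents of a character `ψ` of `G`. -/
def constituents {G : Type*} [Group G] [Finite G] (ψ : G → ℂ) : Set (G → ℂ) :=
  {χ | χ ∈ Irr G ∧ charInner χ ψ ≠ 0}

/-- The complex-valued function underlying a linear character. -/
def linChar {G : Type*} [Group G] (lam : G →* ℂˣ) : G → ℂ := fun g => (lam g : ℂ)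

/-! ### The unitriangular group and its root subgroups -/

/-- `U_n(F)`: the upper triangular matrices with all diagonal entries equal to `1`. -/
def unitri (n : ℕ) (F : Type*) [Field F] : Subgroup (GL (Fin n) F) where
  carrier := {g | (∀ i j, j < i → (g : Matrix (Fin n) (Fin n) F) i j = 0) ∧
    ∀ i, (g : Matrix (Fin n) (Fin n) F) i i = 1}
  one_mem' := by
    refine ⟨fun i j h => ?_, fun i => ?_⟩
    · simp [h.ne']
    · simp
  mul_mem' := by
    rintro a b ⟨ha, ha'⟩ ⟨hb, hb'⟩
    refine ⟨fun i j h => ?_, fun i => ?_⟩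
    · simp only [Units.val_mul, Matrix.mul_apply]
      refine Finset.sum_eq_zero fun k _ => ?_
      rcases lt_or_ge k i with hk | hk
      · simp [ha i k hk]
      · simp [hb k j (h.trans_le hk)]
    · simp only [Units.val_mul, Matrix.mul_apply]
      rw [Finset.sum_eq_single i]
      · simp [ha', hb']
      · intro k _ hk
        rcases lt_or_gt_of_ne hk with hk | hk
        · simp [ha i k hk]
        · simp [hb k i hk]
      · simp
  inv_mem' := by
    rintro a ⟨ha, ha'⟩
    have hT : Matrix.BlockTriangular (a : Matrix (Fin n) (Fin n) F) id := fun i j h => ha i j h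
    have : Invertible (a : Matrix (Fin n) (Fin n) F) := a.invertible
    have hT' : ∀ i j, j < i → ((a⁻¹ : GL (Fin n) F) : Matrix (Fin n) (Fin n) F) i j = 0 := by
      intro i j h
      have h2 := Matrix.blockTriangular_inv_of_blockTriangular hT
      rw [Matrix.coe_units_inv]
      exact h2 h
    refine ⟨hT', fun i => ?_⟩
    have h1 : ((a : Matrix (Fin n) (Fin n) F) *
        ((a⁻¹ : GL (Fin n) F) : Matrix (Fin n) (Fin n) F)) i i = 1 := by
      rw [Units.mul_inv]; simp
    rw [Matrix.mul_apply, Finset.sum_eq_single i] at h1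
    · simpa [ha'] using h1
    · intro k _ hk
      rcases lt_or_gt_of_ne hk with hk | hk
      · simp [ha i k hk]
      · simp [hT' k i hk]
    · simp

/-- A positive root of `GL_n`, given by the matrix position (strictly above the diagonal) of its
root subgroup: the root `α_i + ⋯ + α_j` (`0 < i ≤ j < n`) has row `i` and column `j + 1`. -/
@[ext]
structure PosRoot (n : ℕ) where
  row : Fin n
  col : Fin n
  lt : row < col

namespace PosRoot

variable {n : ℕ}

/-- The root as the vector `e_row - e_col`; the simple root `α_i` is `e_i - e_{i+1}`. -/
def vec (α : PosRoot n) : Fin n → ℤ := Pi.single α.row 1 - Pi.single α.col 1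

/-- `α + β ∈ Σ⁺`. -/
def AddIsPosRoot (α β : PosRoot n) : Prop := ∃ δ : PosRoot n, α.vec + β.vec = δ.vec

/-- `α <_r β`: the root `β` lies further to the right than `α`. -/
def RightLT (α β : PosRoot n) : Prop := α.col < β.col

/-- `α <_b β`: the root `β` lies further to the bottom than `α`. -/
def BelowLT (α β : PosRoot n) : Prop := α.row < β.row

/-- The arm of `α`: the roots on the row of `α` strictly to the left of `α`. -/
def arm (α : PosRoot n) : Set (PosRoot n) := {β | β.row = α.row ∧ β.col < α.col}

end PosRoot

variable {n : ℕ} (F : Type*) [Field F]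

/-- The element `x_α(d) = I + d · e_{row, col}` of `U_n(F)`. -/
def rootElt {F : Type*} [Field F] (α : PosRoot n) (d : F) : unitri n F :=
  ⟨⟨Matrix.transvection α.row α.col d, Matrix.transvection α.row α.col (-d),
    by rw [Matrix.transvection_mul_transvection_same _ _ α.lt.ne]; simp,
    by rw [Matrix.transvection_mul_transvection_same _ _ α.lt.ne]; simp⟩, by
    refine ⟨fun i j h => ?_, fun i => ?_⟩
    · have : ¬ (α.row = i ∧ α.col = j) := by
        rintro ⟨rfl, rfl⟩; exact absurd α.lt h.asymm
      simp [Matrix.transvection, h.ne', this]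
    · have : ¬ (α.row = i ∧ α.col = i) := by
        rintro ⟨h1, h2⟩; exact α.lt.ne (h1.trans h2.symm)
      simp [Matrix.transvection, this]⟩

/-- The root subgroup `X_α = {x_α(d) : d ∈ F}` of `U_n(F)`. -/
def rootSubgroup (α : PosRoot n) : Subgroup (unitri n F) where
  carrier := Set.range (rootElt α)
  one_mem' := ⟨0, by ext i j; simp [rootElt]⟩
  mul_mem' := by
    rintro _ _ ⟨c, rfl⟩ ⟨d, rfl⟩
    refine ⟨c + d, ?_⟩
    apply Subtype.ext
    apply Units.ext
    exact (Matrix.transvection_mul_transvection_same _ _ α.lt.ne c d).symm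
  inv_mem' := by
    rintro _ ⟨d, rfl⟩
    exact ⟨-d, by apply Subtype.ext; apply Units.ext; rfl⟩

/-- The base group `V_α = ⟨X_β : β ∈ Σ⁺ \ arm(α)⟩`. -/
def baseGroup (α : PosRoot n) : Subgroup (unitri n F) := ⨆ β ∈ (α.arm)ᶜ, rootSubgroup F β

variable {F}

/-- For a linear character `φ` of `(F, +)`, the set of the linear characters `λ_{α,s}`, `s ∈ F^×`,
of `V_α`: `λ_{α,s}(x_α(d)) = φ(d s)`, and `λ_{α,s}` is trivial on the other root subgroups
`X_β ⊆ V_α`. -/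
def baseChars (φ : AddChar F ℂ) (α : PosRoot n) : Set (baseGroup F α →* ℂˣ) :=
  {lam | ∃ s : F, s ≠ 0 ∧
    (∀ (d : F) (h : rootElt α d ∈ baseGroup F α), (lam ⟨rootElt α d, h⟩ : ℂ) = φ (d * s)) ∧
    ∀ β : PosRoot n, β ≠ α → rootSubgroup F β ≤ baseGroup F α →
      ∀ (d : F) (h : rootElt β d ∈ baseGroup F α), lam ⟨rootElt β d, h⟩ = 1}

/-- A basic set: a nonempty set of positive roots, no two of which are on the same row or on the
same column. -/
def IsBasic (D : Finset (PosRoot n)) : Prop :=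
  D.Nonempty ∧ ∀ α ∈ D, ∀ β ∈ D, α ≠ β → α.row ≠ β.row ∧ α.col ≠ β.col

/-- `E(D)`: the families which choose, for each `α ∈ D`, one of the characters `λ_{α,s}`,
`s ∈ F^×`, of `V_α`. -/
def basicData (φ : AddChar F ℂ) (D : Finset (PosRoot n)) :
    Set ((α : D) → (baseGroup F α.1 →* ℂˣ)) :=
  {lam | ∀ α : D, lam α ∈ baseChars φ α.1}

/-- The supercharacter `ξ_D = ∏_{α ∈ D} λ_α^U`, a product of characters of `U` (the character of
a tensor product). -/
def superchar [Finite F] (D : Finset (PosRoot n))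
    (lam : (α : D) → (baseGroup F α.1 →* ℂˣ)) : unitri n F → ℂ :=
  ∏ α : D, induced (baseGroup F α.1).subtype (linChar (lam α))

variable (F) in
/-- `V_D = ⋂_{α ∈ D} V_α`. -/
def VD (D : Finset (PosRoot n)) : Subgroup (unitri n F) := ⨅ α : D, baseGroup F α.1

/-- `λ_D = ∏_{α ∈ D} λ_α|_{V_D}`, a linear character of `V_D`. -/
def lamD (D : Finset (PosRoot n)) (lam : (α : D) → (baseGroup F α.1 →* ℂˣ)) :
    VD F D →* ℂˣ :=
  ∏ α : D, (lam α).comp (Subgroup.inclusion (iInf_le (fun α : D => baseGroup F α.1) α))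

/-- `Γ_D`: the roots `γ` such that for some `τ, σ ∈ D` with `τ <_r σ` and `τ <_b σ`, the root `γ`
is on the row of `τ` and `γ + σ` is a positive root. -/
def GammaD (D : Finset (PosRoot n)) : Set (PosRoot n) :=
  {γ | ∃ τ ∈ D, ∃ σ ∈ D, τ.RightLT σ ∧ τ.BelowLT σ ∧ γ.row = τ.row ∧ γ.AddIsPosRoot σ}

variable (F) in
/-- `R_D = ⟨X_γ : γ ∈ Γ_D⟩`. -/
def RD (D : Finset (PosRoot n)) : Subgroup (unitri n F) := ⨆ γ ∈ GammaD D, rootSubgroup F γ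

variable (F) in
/-- `⟨V_D, R_D⟩`. -/
def VRD (D : Finset (PosRoot n)) : Subgroup (unitri n F) := VD F D ⊔ RD F D

/-- The induced character `λ_D^{⟨V_D, R_D⟩}`. -/
def lamDVRD [Finite F] (D : Finset (PosRoot n)) (lam : (α : D) → (baseGroup F α.1 →* ℂˣ)) :
    VRD F D → ℂ :=
  induced (Subgroup.inclusion (le_sup_left : VD F D ≤ VRD F D)) (linChar (lamD D lam))

end SuperChar

end

/-! For (i), `V_α` consists of the matrices that vanish on the arm of `α`, and the coset `x V_α`
depends only on the row of `α` in `x⁻¹`. The roots of `D` lie on different rows, so these rows can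
be prescribed independently: `U / V_D` is the product of the `U / V_α`. Multiplying the coset sums
for the factors then gives the coset sum for `λ_D^U` (`superchar_eq_induced_lamD`), and transitivity
of induction inserts `H = ⟨V_D, R_D⟩`.

For (ii) and (iii), it suffices that induction from `H` to `U` is isometric on the constituents of
`λ_D^H`. Such a constituent is the conjugation average of a function `f` with `f(a h) = λ_D(a) f(h)`
for `a ∈ V_D` (`exists_eq_induced_id_of_mem_constituents`). The inner product of two induced
functions is a sum over `x ∈ U` of correlations of `f₁`, conjugated by `x`, with `f₂`. The terms
with `x ∈ H` give the inner product on `H`. A term vanishes if `x v = w x` for some `v, w ∈ V_D`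
with `λ_D(v) ≠ λ_D(w)`.

Such `v, w` exist for every `x ∉ H` (`exists_lamD_ne`): for an elementary matrix `E` and `X` the
matrix of `x`, the identity `X (1 + E X) = (1 + X E) X` suggests `v = 1 + E X` and `w = 1 + X E`.
With `E` well placed both lie in `V_D`, while `λ_D(v) = 1 ≠ λ_D(w)`. Norm one then gives
irreducibility, and orthogonality gives distinctness. -/

noncomputable section

namespace SuperChar

/-! ### Induction of functions, and intertwining elements -/

section Functions

variable {K H G : Type*} [Group K] [Group H] [Group G]

/-- The function on `G` which sums `χ` over the fibres of `f`; for an embedding `f` this is the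
extension of `χ` by zero. -/
def extendZero (f : H →* G) (χ : H → ℂ) (y : G) : ℂ := ∑ᶠ (h : H) (_ : f h = y), χ h

theorem extendZero_apply (f : H →* G) (hf : Function.Injective f) (χ : H → ℂ) (h : H) :
    extendZero f χ (f h) = χ h := by
  unfold extendZero
  rw [finsum_eq_single _ h]
  · simp
  · intro k hk
    simp [hf.ne hk]

theorem extendZero_of_notMem_range (f : H →* G) (χ : H → ℂ) {y : G} (hy : y ∉ f.range) :
    extendZero f χ y = 0 := by
  unfold extendZero
  refine finsum_eq_zero_of_forall_eq_zero fun h => ?_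
  have : f h ≠ y := fun e => hy ⟨h, e⟩
  simp [this]

theorem extendZero_id (χ : G → ℂ) : extendZero (MonoidHom.id G) χ = χ :=
  funext fun g => extendZero_apply (MonoidHom.id G) Function.injective_id χ g

theorem extendZero_map_mul (f : H →* G) (hf : Function.Injective f) (χ : H → ℂ) (a : H) (c : ℂ)
    (ha : ∀ h, χ (a * h) = c * χ h) (y : G) :
    extendZero f χ (f a * y) = c * extendZero f χ y := by
  by_cases hy : y ∈ f.range
  · obtain ⟨h, rfl⟩ := hy
    rw [← map_mul, extendZero_apply f hf, extendZero_apply f hf, ha]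
  · rw [extendZero_of_notMem_range f χ hy, extendZero_of_notMem_range f χ, mul_zero]
    rwa [Subgroup.mul_mem_cancel_left _ (MonoidHom.mem_range.2 ⟨a, rfl⟩)]

theorem sum_mul_extendZero [Fintype H] [Fintype G] (f : H →* G) (hf : Function.Injective f)
    (χ : H → ℂ) (ψ : G → ℂ) :
    ∑ g, ψ g * starRingEnd ℂ (extendZero f χ g) = ∑ h, ψ (f h) * starRingEnd ℂ (χ h) := by
  classical
  have : ∑ h, ψ (f h) * starRingEnd ℂ (χ h) =
      ∑ g ∈ Finset.univ.map ⟨f, hf⟩, ψ g * starRingEnd ℂ (extendZero f χ g) := by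
    rw [Finset.sum_map]
    refine Finset.sum_congr rfl fun h _ => ?_
    simp [extendZero_apply f hf]
  rw [this]
  refine (Finset.sum_subset (Finset.subset_univ _) fun g _ hg => ?_).symm
  rw [extendZero_of_notMem_range, map_zero, mul_zero]
  rintro ⟨h, rfl⟩
  exact hg (by simp)

variable [Finite K]

theorem star_linChar (lam : K →* ℂˣ) (a : K) :
    starRingEnd ℂ (lam a : ℂ) = ((lam a)⁻¹ : ℂˣ) := by
  have hn : ‖(lam a : ℂ)‖ = 1 := by
    refine Complex.norm_eq_one_of_pow_eq_one (n := Nat.card K) ?_ Nat.card_pos.ne'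
    rw [← Units.val_pow_eq_pow_val, ← map_pow, pow_card_eq_one', map_one, Units.val_one]
  rw [Units.val_inv_eq_inv_val, Complex.inv_def, Complex.normSq_eq_norm_sq, hn]
  simp

/-- An element carrying some `v` to `w` with `lam v ≠ lam w` does not intertwine functions which
transform under `lam`. -/
theorem sum_extendZero_eq_zero [Fintype G] (j : H →* G) (hj : Function.Injective j) (i : K →* H)
    (lam : K →* ℂˣ) (f₁ f₂ : H → ℂ) (h₁ : ∀ a h, f₁ (i a * h) = lam a * f₁ h)
    (h₂ : ∀ a h, f₂ (i a * h) = lam a * f₂ h) (x : G) (v w : K)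
    (hx : x * j (i v) = j (i w) * x) (hne : lam v ≠ lam w) :
    ∑ g : G, extendZero j f₁ (x⁻¹ * g * x) * starRingEnd ℂ (extendZero j f₂ g) = 0 := by
  set S := ∑ g : G, extendZero j f₁ (x⁻¹ * g * x) * starRingEnd ℂ (extendZero j f₂ g) with hS
  -- Substituting `w g` for `g` turns `x⁻¹ g x` into `v (x⁻¹ g x)`, so the sum is multiplied by
  -- `λ(v) λ(w)⁻¹ ≠ 1` and must be zero.
  have key : S = (lam v : ℂ) * ((lam w)⁻¹ : ℂˣ) * S := by
    conv_lhs => rw [hS]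
    rw [← Equiv.sum_comp (Equiv.mulLeft (j (i w))), hS, Finset.mul_sum]
    refine Finset.sum_congr rfl fun g _ => ?_
    have e : x⁻¹ * (j (i w) * g) * x = j (i v) * (x⁻¹ * g * x) := by
      have : x⁻¹ * j (i w) = j (i v) * x⁻¹ := by
        rw [inv_mul_eq_iff_eq_mul, ← mul_assoc, hx, mul_inv_cancel_right]
      simp only [← mul_assoc, this]
    rw [Equiv.coe_mulLeft, e, extendZero_map_mul j hj f₁ _ _ (h₁ v),
      extendZero_map_mul j hj f₂ _ _ (h₂ w), map_mul, star_linChar]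
    ring
  by_contra hne0
  refine hne ?_
  have h1 : (lam v : ℂ) * ((lam w)⁻¹ : ℂˣ) = 1 :=
    mul_right_cancel₀ hne0 (by rw [← key, one_mul])
  rw [← Units.val_mul, Units.val_eq_one, mul_inv_eq_one] at h1
  exact h1

variable [Finite H]

theorem induced_apply [Fintype G] (f : H →* G) (χ : H → ℂ) (g : G) :
    induced f χ g = (Nat.card H : ℂ)⁻¹ * ∑ x, extendZero f χ (x⁻¹ * g * x) := by
  rw [induced, finsum_eq_sum_of_fintype]
  rfl

/-- Conjugation by elements of `H` preserves the range of `j`, so off that range every term on the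
right vanishes. -/
theorem extendZero_induced [Fintype H] (i : K →* H) (j : H →* G) (hj : Function.Injective j)
    (χ : K → ℂ) (z : G) :
    extendZero j (induced i χ) z =
      (Nat.card K : ℂ)⁻¹ * ∑ y : H, extendZero (j.comp i) χ ((j y)⁻¹ * z * j y) := by
  by_cases hz : z ∈ j.range
  · obtain ⟨h, rfl⟩ := hz
    rw [extendZero_apply j hj, induced_apply]
    congr 1
    refine Finset.sum_congr rfl fun y _ => ?_
    rw [← map_inv, ← map_mul, ← map_mul, extendZero, extendZero]
    simp only [MonoidHom.comp_apply, hj.eq_iff]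
  · rw [extendZero_of_notMem_range _ _ hz, Finset.sum_eq_zero, mul_zero]
    rintro y -
    refine extendZero_of_notMem_range _ _ fun ⟨k, hk⟩ => hz ⟨y * i k * y⁻¹, ?_⟩
    rw [MonoidHom.comp_apply] at hk
    rw [map_mul, map_mul, hk, map_inv]
    group

variable [Fintype G]

theorem induced_id_apply (χ : G → ℂ) (g : G) :
    induced (MonoidHom.id G) χ g = (Nat.card G : ℂ)⁻¹ * ∑ x, χ (x⁻¹ * g * x) := by
  rw [induced_apply, extendZero_id]

theorem charInner_apply (χ ψ : G → ℂ) :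
    charInner χ ψ = (Nat.card G : ℂ)⁻¹ * ∑ g, χ g * starRingEnd ℂ (ψ g) := by
  rw [charInner, finsum_eq_sum_of_fintype]

theorem induced_induced (i : K →* H) (j : H →* G) (hj : Function.Injective j) (χ : K → ℂ) :
    induced j (induced i χ) = induced (j.comp i) χ := by
  have := Fintype.ofFinite H
  ext g
  have hH : (Nat.card H : ℂ) ≠ 0 := Nat.cast_ne_zero.2 Nat.card_pos.ne'
  rw [induced_apply, induced_apply]
  simp_rw [extendZero_induced i j hj]
  rw [← Finset.mul_sum, Finset.sum_comm]
  have : ∀ y : H, ∑ x : G, extendZero (j.comp i) χ ((j y)⁻¹ * (x⁻¹ * g * x) * j y) =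
      ∑ x : G, extendZero (j.comp i) χ (x⁻¹ * g * x) := fun y =>
    Fintype.sum_equiv (Equiv.mulRight (j y)) _ _ fun x => by simp [mul_assoc]
  simp_rw [this]
  rw [Finset.sum_const, Finset.card_univ, nsmul_eq_mul, ← Nat.card_eq_fintype_card,
    mul_left_comm, inv_mul_cancel_left₀ hH]

/-- Writes `λ^H` as a conjugation average on `H`, the same form as its constituents, so that one
isometry statement covers both. -/
theorem induced_eq_induced_id (i : H →* G) (χ : H → ℂ) :
    induced i χ = induced (MonoidHom.id G)
      (fun g => (Nat.card G : ℂ) * (Nat.card H : ℂ)⁻¹ * extendZero i χ g) := by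
  ext g
  have hG : (Nat.card G : ℂ) ≠ 0 := Nat.cast_ne_zero.2 Nat.card_pos.ne'
  rw [induced_apply, induced_id_apply, ← Finset.mul_sum, mul_assoc, inv_mul_cancel_left₀ hG]

/-- The inner product of two induced functions as a sum over `G × G`. -/
theorem charInner_induced (j : H →* G) (f₁ f₂ : H → ℂ) :
    charInner (induced j f₁) (induced j f₂) = ((Nat.card H : ℂ)⁻¹ * (Nat.card H : ℂ)⁻¹) *
      ∑ x : G, ∑ g : G, extendZero j f₁ (x⁻¹ * g * x) * starRingEnd ℂ (extendZero j f₂ g) := by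
  have hG : (Nat.card G : ℂ) ≠ 0 := Nat.cast_ne_zero.2 Nat.card_pos.ne'
  rw [charInner_apply]
  -- Replacing `x` by `y⁻¹ x` and `g` by `y⁻¹ g y` removes `y`; the sum over `y` then cancels the
  -- factor `|G|⁻¹`.
  have h : ∀ y : G, ∑ g : G, ∑ x : G, extendZero j f₁ (x⁻¹ * g * x) *
        starRingEnd ℂ (extendZero j f₂ (y⁻¹ * g * y)) =
      ∑ x : G, ∑ g : G, extendZero j f₁ (x⁻¹ * g * x) * starRingEnd ℂ (extendZero j f₂ g) := by
    intro y
    rw [Finset.sum_comm]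
    refine Fintype.sum_equiv (Equiv.mulLeft y⁻¹) _ _ fun x => ?_
    refine Fintype.sum_equiv ((Equiv.mulLeft y⁻¹).trans (Equiv.mulRight y)) _ _ fun g => ?_
    simp [mul_assoc]
  have h' : ∀ g : G, induced j f₁ g * starRingEnd ℂ (induced j f₂ g) =
      ((Nat.card H : ℂ)⁻¹ * (Nat.card H : ℂ)⁻¹) * ∑ y : G, ∑ x : G,
        extendZero j f₁ (x⁻¹ * g * x) * starRingEnd ℂ (extendZero j f₂ (y⁻¹ * g * y)) := by
    intro g
    rw [induced_apply, induced_apply]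
    simp_rw [← Finset.sum_mul, ← Finset.mul_sum]
    simp only [map_mul, map_inv₀, map_natCast, map_sum]
    ring
  simp_rw [h']
  rw [← Finset.mul_sum, Finset.sum_comm]
  simp_rw [h]
  rw [Finset.sum_const, Finset.card_univ, nsmul_eq_mul, ← Nat.card_eq_fintype_card,
    mul_left_comm, inv_mul_cancel_left₀ hG]

/-- If only the elements of `H` intertwine `f₁` and `f₂`, then induction from `H` to `G`
preserves the inner product of the class functions obtained from `f₁` and `f₂`. -/
theorem charInner_induced_eq [Fintype H] (j : H →* G) (hj : Function.Injective j) (f₁ f₂ : H → ℂ)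
    (h : ∀ x ∉ j.range, ∑ g : G, extendZero j f₁ (x⁻¹ * g * x) *
      starRingEnd ℂ (extendZero j f₂ g) = 0) :
    charInner (induced j f₁) (induced j f₂) =
      charInner (induced (MonoidHom.id H) f₁) (induced (MonoidHom.id H) f₂) := by
  classical
  rw [charInner_induced, charInner_induced]
  congr 1
  have : ∑ x : H, ∑ g : H, extendZero (MonoidHom.id H) f₁ (x⁻¹ * g * x) *
      starRingEnd ℂ (extendZero (MonoidHom.id H) f₂ g) =
      ∑ x ∈ Finset.univ.map ⟨j, hj⟩, ∑ g : G, extendZero j f₁ (x⁻¹ * g * x) *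
        starRingEnd ℂ (extendZero j f₂ g) := by
    rw [Finset.sum_map]
    refine Finset.sum_congr rfl fun x _ => ?_
    rw [sum_mul_extendZero j hj f₂ (fun g => extendZero j f₁ (_⁻¹ * g * _))]
    refine Finset.sum_congr rfl fun y _ => ?_
    simp only [extendZero_id, Function.Embedding.coeFn_mk]
    rw [← map_inv, ← map_mul, ← map_mul, extendZero_apply j hj]
  rw [this]
  refine (Finset.sum_subset (Finset.subset_univ _) fun x _ hx => h x ?_).symm
  rintro ⟨y, rfl⟩
  exact hx (by simp)

end Functions

/-! ### Character theory: unitarity, norm one, Schur's lemma -/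

section Representations

open Representation Module

variable {G V : Type*} [Group G] [AddCommGroup V] [Module ℂ V]

open scoped ComplexOrder in
-- Unitarian trick: `M = ∑ A(x)ᴴ A(x)` is positive definite and invariant, so `A(g)ᴴ` is conjugate
-- to `A(g⁻¹)` by `M`; compare traces.
theorem character_inv_eq_star [Finite G] [FiniteDimensional ℂ V] (ρ : Representation ℂ G V)
    (g : G) : ρ.character g⁻¹ = starRingEnd ℂ (ρ.character g) := by
  classical
  have := Fintype.ofFinite G
  let b := finBasis ℂ V
  let A : G → Matrix (Fin (finrank ℂ V)) (Fin (finrank ℂ V)) ℂ := fun x =>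
    LinearMap.toMatrix b b (ρ x)
  have hmul : ∀ x y, A (x * y) = A x * A y := fun x y => by
    simp only [A, map_mul, LinearMap.toMatrix_mul]
  have hone : A 1 = 1 := by simp [A]
  have htr : ∀ x, ρ.character x = (A x).trace := fun x =>
    LinearMap.trace_eq_matrix_trace ℂ b (ρ x)
  set M := ∑ x, (A x).conjTranspose * A x with hM
  have hpos : M.PosDef := by
    rw [hM, ← Finset.add_sum_erase _ _ (Finset.mem_univ 1)]
    refine Matrix.PosDef.add_posSemidef ?_ ?_
    · rw [hone]
      simpa using Matrix.PosDef.one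
    · exact Matrix.posSemidef_sum _ fun x _ => Matrix.posSemidef_conjTranspose_mul_self _
  have hinv : (A g).conjTranspose * M * A g = M := by
    rw [hM, Finset.mul_sum, Finset.sum_mul]
    refine Fintype.sum_equiv (Equiv.mulRight g) _ _ fun x => ?_
    simp only [Equiv.coe_mulRight, hmul, Matrix.conjTranspose_mul, Matrix.mul_assoc]
  have hu : IsUnit M.det := (Matrix.isUnit_iff_isUnit_det _).1 hpos.isUnit
  have hg : A g * A g⁻¹ = 1 := by rw [← hmul, mul_inv_cancel, hone]
  have key : (A g).conjTranspose = M * A g⁻¹ * M⁻¹ := by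
    have : (A g).conjTranspose * M = M * A g⁻¹ := by
      conv_rhs => rw [← hinv]
      rw [Matrix.mul_assoc _ (A g), hg, Matrix.mul_one]
    rw [← this, Matrix.mul_assoc, Matrix.mul_nonsing_inv _ hu, Matrix.mul_one]
  rw [htr, htr, starRingEnd_apply, ← Matrix.trace_conjTranspose, key, Matrix.trace_mul_comm,
    ← Matrix.mul_assoc, Matrix.nonsing_inv_mul _ hu, Matrix.one_mul]

/-- The norm is the dimension of the endomorphism algebra, so all endomorphisms are scalar. By
Maschke every submodule is the image of a projection, and a scalar projection has image zero or
everything. -/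
theorem isIrreducible_of_charInner_eq_one [Finite G] [FiniteDimensional ℂ V]
    (ρ : Representation ℂ G V) (h : charInner ρ.character ρ.character = 1) : ρ.IsIrreducible := by
  have := Fintype.ofFinite G
  have hG : (Nat.card G : ℂ) ≠ 0 := Nat.cast_ne_zero.2 Nat.card_pos.ne'
  have : Invertible (Nat.card G : ℂ) := invertibleOfNonzero hG
  have : NeZero (Nat.card G : ℂ) := ⟨hG⟩
  rw [charInner_apply] at h
  simp_rw [← character_inv_eq_star] at h
  rw [card_inv_mul_sum_char_mul_char_eq_finrank] at h
  have h1 : finrank ℂ (IntertwiningMap ρ ρ) = 1 := by exact_mod_cast h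
  rw [irreducible_iff_isSimpleModule_asModule, isSimpleModule_iff]
  have h2 : finrank ℂ (Module.End (MonoidAlgebra ℂ G) ρ.asModule) = 1 := by
    rw [← h1]
    exact (IntertwiningMap.equivAlgEnd (ρ := ρ)).toLinearEquiv.finrank_eq.symm
  have hnt : Nontrivial ρ.asModule := by
    by_contra hn
    rw [not_nontrivial_iff_subsingleton] at hn
    have : Subsingleton (Module.End (MonoidAlgebra ℂ G) ρ.asModule) :=
      ⟨fun f g => LinearMap.ext fun x => Subsingleton.elim _ _⟩
    rw [finrank_zero_of_subsingleton] at h2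
    exact zero_ne_one h2
  refine { exists_pair_ne := ⟨⊥, ⊤, bot_ne_top⟩, eq_bot_or_eq_top := fun W => ?_ }
  obtain ⟨W', hW⟩ := exists_isCompl W
  obtain ⟨c, hc⟩ := (finrank_eq_one_iff_of_nonzero' (1 : Module.End (MonoidAlgebra ℂ G) ρ.asModule)
    one_ne_zero).1 h2 (W.projection W' hW)
  by_cases hc0 : c = 0
  · left
    rw [← Submodule.range_projection hW, ← hc, hc0, zero_smul, LinearMap.range_zero]
  · right
    have hW' : W' = ⊥ := by
      rw [← Submodule.ker_projection hW, ← hc]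
      refine (Submodule.eq_bot_iff _).2 fun x hx => ?_
      have : c • x = 0 := hx
      exact (smul_eq_zero.1 this).resolve_left hc0
    rw [hW'] at hW
    simpa using hW.sup_eq_top

/-- A character of norm one belongs to `Irr G`, whatever the universe of the representation. -/
theorem character_mem_Irr [Finite G] [FiniteDimensional ℂ V] (ρ : Representation ℂ G V)
    (h : charInner ρ.character ρ.character = 1) : ρ.character ∈ Irr G := by
  -- `Irr` only admits spaces in `Type`; coordinates move the representation to `ℂ^d`.
  let e : V ≃ₗ[ℂ] (Fin (finrank ℂ V) → ℂ) := (finBasis ℂ V).equivFun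
  let σ : Representation ℂ G (Fin (finrank ℂ V) → ℂ) :=
    { toFun := fun g => e.conj (ρ g)
      map_one' := by simp [LinearEquiv.conj_id, Module.End.one_eq_id]
      map_mul' := fun g k => by
        rw [map_mul, Module.End.mul_eq_comp, LinearEquiv.conj_comp, Module.End.mul_eq_comp] }
  have hσ : σ.character = ρ.character := funext fun g => LinearMap.trace_conj' (ρ g) e
  exact ⟨_, _, _, inferInstance, σ, isIrreducible_of_charInner_eq_one σ (by rw [hσ]; exact h), hσ⟩

theorem charInner_self_of_mem_Irr [Finite G] {χ : G → ℂ} (h : χ ∈ Irr G) : charInner χ χ = 1 := by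
  have := Fintype.ofFinite G
  have : Invertible (Nat.card G : ℂ) := invertibleOfNonzero (Nat.cast_ne_zero.2 Nat.card_pos.ne')
  obtain ⟨V, _, _, _, ρ, hρ, rfl⟩ := h
  rw [charInner_apply]
  simp_rw [← character_inv_eq_star]
  rw [char_orthonormal, if_pos ⟨Representation.Equiv.refl ρ⟩]

theorem charInner_of_mem_Irr_of_ne [Finite G] {χ ψ : G → ℂ} (hχ : χ ∈ Irr G) (hψ : ψ ∈ Irr G)
    (hne : χ ≠ ψ) : charInner χ ψ = 0 := by
  have := Fintype.ofFinite G
  have : Invertible (Nat.card G : ℂ) := invertibleOfNonzero (Nat.cast_ne_zero.2 Nat.card_pos.ne')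
  obtain ⟨V, _, _, _, ρ, hρ, rfl⟩ := hχ
  obtain ⟨W, _, _, _, σ, hσ, rfl⟩ := hψ
  rw [charInner_apply]
  simp_rw [← character_inv_eq_star]
  rw [char_orthonormal, if_neg]
  rintro ⟨e⟩
  exact hne (char_iso e).symm

/-- Averaging an operator over an irreducible representation gives a scalar. -/
theorem sum_conj_eq_smul [Fintype G] [FiniteDimensional ℂ V] (ρ : Representation ℂ G V)
    [ρ.IsIrreducible] (E : V →ₗ[ℂ] V) :
    ∑ x, ρ x * E * ρ x⁻¹ =
      ((Nat.card G : ℂ) * LinearMap.trace ℂ V E * (finrank ℂ V : ℂ)⁻¹) • (1 : V →ₗ[ℂ] V) := by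
  have hnt : Nontrivial V := by
    by_contra hn
    rw [not_nontrivial_iff_subsingleton] at hn
    obtain ⟨a, b, hab⟩ := exists_pair_ne (Subrepresentation ρ)
    exact hab (Subrepresentation.toSubmodule_injective (Subsingleton.elim _ _))
  set T := ∑ x, ρ x * E * ρ x⁻¹ with hT
  have hcomm : ∀ g, T * ρ g = ρ g * T := by
    intro g
    rw [hT, Finset.sum_mul, Finset.mul_sum]
    refine Fintype.sum_equiv (Equiv.mulLeft g⁻¹) _ _ fun x => ?_
    simp [mul_assoc, ← map_mul, ← mul_assoc (ρ _) (ρ _)]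
  obtain ⟨c, hc⟩ := IsIrreducible.algebraMap_intertwiningMap_bijective_of_isAlgClosed.2
    (⟨T, hcomm⟩ : IntertwiningMap ρ ρ)
  have hc' : T = c • (1 : V →ₗ[ℂ] V) := by
    have := congrArg IntertwiningMap.toLinearMap hc
    exact this.symm
  have htr : LinearMap.trace ℂ V T = (Nat.card G : ℂ) * LinearMap.trace ℂ V E := by
    rw [hT, map_sum]
    have : ∀ x, LinearMap.trace ℂ V (ρ x * E * ρ x⁻¹) = LinearMap.trace ℂ V E := fun x => by
      rw [LinearMap.trace_mul_comm, ← mul_assoc, ← map_mul, inv_mul_cancel, map_one, one_mul]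
    simp_rw [this]
    rw [Finset.sum_const, Finset.card_univ, nsmul_eq_mul, Nat.card_eq_fintype_card]
  have hd : (finrank ℂ V : ℂ) ≠ 0 := Nat.cast_ne_zero.2 finrank_pos.ne'
  rw [hc', ← htr, hc', map_smul, LinearMap.trace_one, smul_eq_mul, mul_inv_cancel_right₀ hd]

end Representations

/-! ### Constituents of an induced linear character -/

section Constituents

open Representation Module

variable {L H : Type*} [Group L] [Group H] [Finite L]

/-- Frobenius reciprocity, for a class function. -/
theorem charInner_induced_right [Finite H] [Fintype L] (i : L →* H) (hi : Function.Injective i)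
    (χ : H → ℂ) (hχ : ∀ x g, χ (x * g * x⁻¹) = χ g) (ψ : L → ℂ) :
    charInner χ (induced i ψ) =
      (Nat.card L : ℂ)⁻¹ * ∑ l, χ (i l) * starRingEnd ℂ (ψ l) := by
  have := Fintype.ofFinite H
  have hH : (Nat.card H : ℂ) ≠ 0 := Nat.cast_ne_zero.2 Nat.card_pos.ne'
  rw [charInner_apply]
  have hg : ∀ g, χ g * starRingEnd ℂ (induced i ψ g) = (Nat.card L : ℂ)⁻¹ *
      ∑ x, χ g * starRingEnd ℂ (extendZero i ψ (x⁻¹ * g * x)) := fun g => by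
    rw [induced_apply, map_mul, map_sum, map_inv₀, map_natCast, mul_left_comm, Finset.mul_sum]
  simp_rw [hg]
  rw [← Finset.mul_sum, mul_left_comm, Finset.sum_comm]
  congr 1
  have : ∀ x : H, ∑ g, χ g * starRingEnd ℂ (extendZero i ψ (x⁻¹ * g * x)) =
      ∑ l, χ (i l) * starRingEnd ℂ (ψ l) := fun x => by
    rw [← sum_mul_extendZero i hi]
    refine Fintype.sum_equiv ((Equiv.mulLeft x⁻¹).trans (Equiv.mulRight x)) _ _ fun g => ?_
    have := hχ x (x⁻¹ * g * x)
    simp only [mul_assoc, mul_inv_cancel_left, mul_inv_cancel, mul_one] at this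
    simp [← this, mul_assoc]
  simp_rw [this]
  rw [Finset.sum_const, Finset.card_univ, nsmul_eq_mul, ← Nat.card_eq_fintype_card,
    inv_mul_cancel_left₀ hH]

/-- A constituent of `lam^H` is the average of a function which transforms under `lam`. -/
theorem exists_eq_induced_id_of_mem_constituents [Finite H] (i : L →* H)
    (hi : Function.Injective i) (lam : L →* ℂˣ) {χ : H → ℂ}
    (hχ : χ ∈ constituents (induced i (linChar lam))) :
    ∃ f : H → ℂ, (∀ a h, f (i a * h) = lam a * f h) ∧ χ = induced (MonoidHom.id H) f := by
  have := Fintype.ofFinite H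
  have := Fintype.ofFinite L
  have hH : (Nat.card H : ℂ) ≠ 0 := Nat.cast_ne_zero.2 Nat.card_pos.ne'
  obtain ⟨⟨V, _, _, _, ρ, hρ, rfl⟩, hne⟩ := hχ
  rw [charInner_induced_right i hi _ (fun x g => char_conj ρ g x)] at hne
  -- `E` is `|L|` times the projection onto the `λ`-isotypic part. By Frobenius reciprocity its
  -- trace is a nonzero multiple of the inner product with `λ^H`, hence nonzero.
  set E : V →ₗ[ℂ] V := ∑ l, (((lam l)⁻¹ : ℂˣ) : ℂ) • ρ (i l) with hE
  have htr : LinearMap.trace ℂ V E = ∑ l, ρ.character (i l) * starRingEnd ℂ (linChar lam l) := by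
    rw [hE, map_sum]
    refine Finset.sum_congr rfl fun l _ => ?_
    rw [map_smul, linChar, star_linChar, smul_eq_mul, mul_comm]
    rfl
  rw [← htr] at hne
  have htr0 := right_ne_zero_of_mul hne
  have hmul : ∀ a, E * ρ (i a) = (lam a : ℂ) • E := by
    intro a
    rw [hE, Finset.sum_mul, Finset.smul_sum]
    refine Fintype.sum_equiv (Equiv.mulRight a) _ _ fun l => ?_
    rw [smul_mul_assoc, ← map_mul, ← map_mul, smul_smul, Equiv.coe_mulRight]
    dsimp only
    rw [map_mul lam, mul_inv_rev, ← Units.val_mul, mul_inv_cancel_left]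
  set d : ℂ := (finrank ℂ V : ℂ)
  set c : ℂ := d * (LinearMap.trace ℂ V E)⁻¹
  have hd : d ≠ 0 := by
    intro h0
    have : finrank ℂ V = 0 := Nat.cast_eq_zero.1 h0
    have := finrank_zero_iff.1 this
    exact htr0 (by rw [Subsingleton.elim E 0, map_zero])
  -- Averaging conjugates of `E` gives the scalar `|H| tr(E) / d`; the constant `c = d / tr(E)`
  -- cancels what remains after division by `|H|`.
  refine ⟨fun h => c * LinearMap.trace ℂ V (ρ h * E), fun a h => ?_, ?_⟩
  · dsimp only
    rw [map_mul ρ, mul_assoc (ρ _), LinearMap.trace_mul_comm ℂ (ρ (i a)),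
      mul_assoc (ρ h), hmul, mul_smul_comm, map_smul,
      smul_eq_mul, mul_left_comm]
  · ext h
    rw [induced_id_apply, ← Finset.mul_sum, ← map_sum]
    have : ∑ x, ρ (x⁻¹ * h * x) * E = ∑ x, ρ x⁻¹ * (ρ h * (ρ x * E)) := by
      simp_rw [map_mul, mul_assoc]
    have h2 : LinearMap.trace ℂ V (∑ x, ρ (x⁻¹ * h * x) * E) =
        LinearMap.trace ℂ V (ρ h * ∑ x, ρ x * E * ρ x⁻¹) := by
      rw [this, Finset.mul_sum, map_sum, map_sum]
      refine Finset.sum_congr rfl fun x _ => ?_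
      rw [LinearMap.trace_mul_comm, mul_assoc]
    rw [h2, sum_conj_eq_smul, mul_smul_comm, mul_one, map_smul, smul_eq_mul]
    change ρ.character h = _ * (c * (_ * _ * d⁻¹ * ρ.character h))
    simp only [c]
    field_simp

end Constituents

/-! ### The induced representation and its character -/

section InducedRepresentation

open Representation Module

variable {G V : Type*} [Group G] [AddCommGroup V] [Module ℂ V]

theorem sum_eq_card_mul_sum_quotient [Fintype G] (H : Subgroup G) [Fintype (G ⧸ H)] (φ : G → ℂ)
    (hφ : ∀ x, ∀ h ∈ H, φ (x * h) = φ x) :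
    ∑ x, φ x = (Nat.card H : ℂ) * ∑ c : G ⧸ H, φ c.out := by
  have := Fintype.ofFinite H
  have hb : Function.Bijective (fun p : (G ⧸ H) × H => p.1.out * (p.2 : G)) := by
    constructor
    · rintro ⟨c, h⟩ ⟨c', h'⟩ e
      dsimp only at e
      have hc : c = c' := by
        rw [← QuotientGroup.out_eq' c, ← QuotientGroup.out_eq' c',
          ← QuotientGroup.mk_mul_of_mem c.out h.2, e, QuotientGroup.mk_mul_of_mem c'.out h'.2]
      subst hc
      rw [mul_left_cancel_iff] at e
      rw [Subtype.ext e]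
    · intro x
      refine ⟨⟨(x : G ⧸ H), ⟨(x : G ⧸ H).out⁻¹ * x, ?_⟩⟩, by simp⟩
      rw [← QuotientGroup.eq, QuotientGroup.out_eq']
  rw [← Fintype.sum_bijective _ hb (fun p => φ p.1.out) _ fun p => (hφ _ _ p.2.2).symm,
    Fintype.sum_prod_type, Finset.mul_sum]
  refine Finset.sum_congr rfl fun c _ => ?_
  dsimp only
  rw [Finset.sum_const, Finset.card_univ, nsmul_eq_mul, Nat.card_eq_fintype_card]

theorem extendZero_subtype_conj (H : Subgroup G) (χ : H → ℂ)
    (hχ : ∀ x g, χ (x * g * x⁻¹) = χ g) (z : G) {h : G} (hh : h ∈ H) :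
    extendZero H.subtype χ (h⁻¹ * z * h) = extendZero H.subtype χ z := by
  by_cases hz : z ∈ H
  · have h1 := extendZero_apply H.subtype H.subtype_injective χ ⟨z, hz⟩
    have h2 := extendZero_apply H.subtype H.subtype_injective χ (⟨h, hh⟩⁻¹ * ⟨z, hz⟩ * ⟨h, hh⟩)
    have h3 := hχ ⟨h, hh⟩⁻¹ ⟨z, hz⟩
    rw [inv_inv] at h3
    rw [h3, ← h1] at h2
    exact h2
  · rw [extendZero_of_notMem_range, extendZero_of_notMem_range]
    · simpa using hz
    · rwa [Subgroup.range_subtype, Subgroup.mul_mem_cancel_right _ hh,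
        Subgroup.mul_mem_cancel_left _ (H.inv_mem hh)]

theorem induced_subtype_apply [Finite G] (H : Subgroup G) [Fintype (G ⧸ H)] (χ : H → ℂ)
    (hχ : ∀ x g, χ (x * g * x⁻¹) = χ g) (g : G) :
    induced H.subtype χ g = ∑ c : G ⧸ H, extendZero H.subtype χ (c.out⁻¹ * g * c.out) := by
  have := Fintype.ofFinite G
  have hH : (Nat.card H : ℂ) ≠ 0 := Nat.cast_ne_zero.2 Nat.card_pos.ne'
  rw [induced_apply, sum_eq_card_mul_sum_quotient H, inv_mul_cancel_left₀ hH]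
  intro x h hh
  have e : (x * h)⁻¹ * g * (x * h) = h⁻¹ * (x⁻¹ * g * x) * h := by group
  rw [e, extendZero_subtype_conj H χ hχ _ hh]

/-- The element of `H` by which `g` acts between the fibres over `g⁻¹ • c` and `c`. -/
def cosetCocycle (H : Subgroup G) (g : G) (c : G ⧸ H) : H :=
  ⟨c.out⁻¹ * g * (g⁻¹ • c).out, by
    rw [mul_assoc, ← QuotientGroup.eq, QuotientGroup.out_eq']
    change c = g • (((g⁻¹ • c).out : G) : G ⧸ H)
    rw [QuotientGroup.out_eq', smul_inv_smul]⟩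

theorem cosetCocycle_one (H : Subgroup G) (c : G ⧸ H) : cosetCocycle H 1 c = 1 :=
  Subtype.ext (by simp [cosetCocycle])

theorem cosetCocycle_mul (H : Subgroup G) (g k : G) (c : G ⧸ H) :
    cosetCocycle H (g * k) c = cosetCocycle H g c * cosetCocycle H k (g⁻¹ • c) :=
  Subtype.ext (by simp [cosetCocycle, mul_smul, mul_assoc])

/-- The representation of `G` induced from `H`, on functions on the cosets. -/
def inducedRep (H : Subgroup G) (ρ : Representation ℂ H V) : Representation ℂ G (G ⧸ H → V) where
  toFun g := LinearMap.pi fun c => ρ (cosetCocycle H g c) ∘ₗ LinearMap.proj (g⁻¹ • c)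
  map_one' := by
    refine LinearMap.ext fun f => funext fun c => ?_
    simp [cosetCocycle_one]
  map_mul' g k := by
    refine LinearMap.ext fun f => funext fun c => ?_
    simp [cosetCocycle_mul, mul_smul]

/-- Split `T` along the identity as a sum over coordinates and use `tr(AB) = tr(BA)`. -/
theorem trace_pi {ι : Type*} [Fintype ι] [FiniteDimensional ℂ V] (T : (ι → V) →ₗ[ℂ] (ι → V)) :
    LinearMap.trace ℂ _ T = open Classical in
      ∑ c, LinearMap.trace ℂ V (LinearMap.proj c ∘ₗ T ∘ₗ LinearMap.single ℂ (fun _ => V) c) := by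
  classical
  have : T = ∑ c, (T ∘ₗ LinearMap.single ℂ (fun _ => V) c) ∘ₗ LinearMap.proj c := by
    refine LinearMap.ext fun f => ?_
    rw [LinearMap.sum_apply]
    simp only [LinearMap.comp_apply, LinearMap.proj_apply, ← map_sum]
    congr 1
    exact (LinearMap.sum_single_apply _ f).symm
  conv_lhs => rw [this, map_sum]
  refine Finset.sum_congr rfl fun c _ => ?_
  rw [LinearMap.trace_comp_comm']

/-- Only cosets fixed by `g` have a nonzero diagonal block. For the others `c.out⁻¹ * g * c.out` is
outside `H`, where the extension by zero vanishes too. -/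
theorem character_inducedRep [Finite G] [FiniteDimensional ℂ V] (H : Subgroup G)
    (ρ : Representation ℂ H V) :
    (inducedRep H ρ).character = induced H.subtype ρ.character := by
  classical
  have := Fintype.ofFinite (G ⧸ H)
  ext g
  rw [induced_subtype_apply H _ fun x g => char_conj ρ g x, character, trace_pi]
  refine Finset.sum_congr rfl fun c _ => ?_
  by_cases hc : g⁻¹ • c = c
  · have hm : cosetCocycle H g c = c.out⁻¹ * g * c.out := by
      simp only [cosetCocycle, hc]
    rw [← hm, ← H.subtype_apply, extendZero_apply _ H.subtype_injective, character]
    congr 1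
    refine LinearMap.ext fun v => ?_
    simp [inducedRep, hc]
  · rw [extendZero_of_notMem_range]
    · convert map_zero (LinearMap.trace ℂ V)
      refine LinearMap.ext fun v => ?_
      simp [inducedRep, hc]
    · rw [Subgroup.range_subtype, mul_assoc, ← QuotientGroup.eq, QuotientGroup.out_eq']
      intro h
      apply hc
      rw [inv_smul_eq_iff]
      conv_rhs => rw [← QuotientGroup.out_eq' c]
      exact h

end InducedRepresentation

/-! ### Isometry of induction on constituents -/

section InducedConstituents

variable {L G : Type*} [Group L] [Group G] [Finite L] [Finite G] (H : Subgroup G)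

theorem charInner_induced_subtype_eq (i : L →* H) (lam : L →* ℂˣ)
    (hint : ∀ x ∉ H, ∃ v w, x * i v = i w * x ∧ lam v ≠ lam w) (f₁ f₂ : H → ℂ)
    (h₁ : ∀ a h, f₁ (i a * h) = lam a * f₁ h) (h₂ : ∀ a h, f₂ (i a * h) = lam a * f₂ h) :
    charInner (induced H.subtype (induced (MonoidHom.id H) f₁))
      (induced H.subtype (induced (MonoidHom.id H) f₂)) =
      charInner (induced (MonoidHom.id H) f₁) (induced (MonoidHom.id H) f₂) := by
  have := Fintype.ofFinite G
  have := Fintype.ofFinite H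
  rw [induced_induced _ _ H.subtype_injective, induced_induced _ _ H.subtype_injective,
    MonoidHom.comp_id]
  refine charInner_induced_eq H.subtype H.subtype_injective f₁ f₂ fun x hx => ?_
  rw [Subgroup.range_subtype] at hx
  obtain ⟨v, w, hvw, hne⟩ := hint x hx
  exact sum_extendZero_eq_zero H.subtype H.subtype_injective i lam f₁ f₂ h₁ h₂ x v w hvw hne

/-- If every element intertwining `lam` lies in `H`, induction to `G` sends the constituents of
`lam^H` to constituents of `lam^G`. -/
theorem induced_mem_constituents (i : L →* H) (hi : Function.Injective i) (lam : L →* ℂˣ)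
    (hint : ∀ x ∉ H, ∃ v w, x * i v = i w * x ∧ lam v ≠ lam w) {χ : H → ℂ}
    (hχ : χ ∈ constituents (induced i (linChar lam))) :
    induced H.subtype χ ∈ constituents (induced H.subtype (induced i (linChar lam))) := by
  have := Fintype.ofFinite H
  obtain ⟨f, hf, hfχ⟩ := exists_eq_induced_id_of_mem_constituents i hi lam hχ
  constructor
  · have h1 := charInner_self_of_mem_Irr hχ.1
    rw [hfχ, ← charInner_induced_subtype_eq H i lam hint f f hf hf, ← hfχ] at h1
    obtain ⟨⟨V, _, _, _, ρ, hρ, rfl⟩, -⟩ := hχ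
    rw [← character_inducedRep] at h1 ⊢
    exact character_mem_Irr _ h1
  · have h2 := hχ.2
    -- `λ^H` is the average of a multiple of `λ` extended by zero, which transforms under `λ`, so
    -- the isometry also preserves the inner product with `λ^H`.
    rw [induced_eq_induced_id i] at h2 ⊢
    rw [hfχ] at h2 ⊢
    rwa [charInner_induced_subtype_eq H i lam hint _ _ hf]
    intro a h
    rw [extendZero_map_mul i hi _ a (lam a) fun l => ?_]
    · ring
    · simp [linChar]

/-- If the induced characters agreed, the norm one of the first would equal the inner product of
`χ₁` and `χ₂`, which is zero. -/
theorem induced_ne_induced (i : L →* H) (hi : Function.Injective i) (lam : L →* ℂˣ)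
    (hint : ∀ x ∉ H, ∃ v w, x * i v = i w * x ∧ lam v ≠ lam w) {χ₁ χ₂ : H → ℂ}
    (h₁ : χ₁ ∈ constituents (induced i (linChar lam)))
    (h₂ : χ₂ ∈ constituents (induced i (linChar lam))) (hne : χ₁ ≠ χ₂) :
    induced H.subtype χ₁ ≠ induced H.subtype χ₂ := by
  obtain ⟨f₁, hf₁, e₁⟩ := exists_eq_induced_id_of_mem_constituents i hi lam h₁
  obtain ⟨f₂, hf₂, e₂⟩ := exists_eq_induced_id_of_mem_constituents i hi lam h₂
  intro he
  have h0 := charInner_of_mem_Irr_of_ne h₁.1 h₂.1 hne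
  have h3 := charInner_self_of_mem_Irr (induced_mem_constituents H i hi lam hint h₁).1
  nth_rewrite 2 [he] at h3
  rw [e₁, e₂, charInner_induced_subtype_eq H i lam hint f₁ f₂ hf₁ hf₂, ← e₁, ← e₂, h0] at h3
  exact zero_ne_one h3

end InducedConstituents

/-! ### Matrix entries, `V_α` and its linear characters -/

section Unitriangular

variable {n : ℕ} {F : Type*} [Field F]

/-- The `(i, j)` entry of a unitriangular matrix. -/
def entry (u : unitri n F) (i j : Fin n) : F := ((u : GL (Fin n) F) : Matrix (Fin n) (Fin n) F) i j

theorem entry_of_lt (u : unitri n F) {i j : Fin n} (h : j < i) : entry u i j = 0 := u.2.1 i j h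

theorem entry_self (u : unitri n F) (i : Fin n) : entry u i i = 1 := u.2.2 i

theorem unitri_ext {u v : unitri n F} (h : ∀ i j, i < j → entry u i j = entry v i j) : u = v := by
  refine Subtype.ext (Units.ext (Matrix.ext fun i j => ?_))
  change entry u i j = entry v i j
  rcases lt_trichotomy i j with hij | rfl | hij
  · exact h i j hij
  · rw [entry_self, entry_self]
  · rw [entry_of_lt u hij, entry_of_lt v hij]

theorem entry_one {i j : Fin n} (h : i ≠ j) : entry (1 : unitri n F) i j = 0 :=
  Matrix.one_apply_ne h

theorem entry_mul (u v : unitri n F) (i j : Fin n) :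
    entry (u * v) i j = ∑ k, entry u i k * entry v k j :=
  Matrix.mul_apply

theorem entry_mul_of_forall (u v : unitri n F) {i j : Fin n} (hij : i < j)
    (h : ∀ k, i < k → k < j → entry u i k = 0) : entry (u * v) i j = entry u i j + entry v i j := by
  rw [entry_mul, Fintype.sum_eq_add i j hij.ne, entry_self, entry_self, one_mul, mul_one, add_comm]
  rintro k ⟨hki, hkj⟩
  rcases lt_or_gt_of_ne hki with h1 | h1
  · rw [entry_of_lt u h1, zero_mul]
  · rcases lt_or_gt_of_ne hkj with h2 | h2
    · rw [h k h1 h2, zero_mul]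
    · rw [entry_of_lt v h2, mul_zero]

theorem entry_inv_of_forall (u : unitri n F) {i j : Fin n} (hij : i < j)
    (h : ∀ k, i < k → k < j → entry u i k = 0) : entry u⁻¹ i j = -entry u i j := by
  have := entry_mul_of_forall u u⁻¹ hij h
  rw [mul_inv_cancel, entry_one hij.ne] at this
  exact (neg_eq_of_add_eq_zero_right this.symm).symm

/-- The element of `U_n(F)` with a given unitriangular matrix. -/
def ofMatrix (M : Matrix (Fin n) (Fin n) F) (h₀ : ∀ i j, j < i → M i j = 0) (h₁ : ∀ i, M i i = 1) :
    unitri n F :=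
  ⟨Matrix.GeneralLinearGroup.mkOfDetNeZero M (by
    rw [Matrix.det_of_isUpperTriangular (fun i j h => h₀ i j h)]
    simp [h₁]), h₀, h₁⟩

theorem entry_ofMatrix (M : Matrix (Fin n) (Fin n) F) (h₀ : ∀ i j, j < i → M i j = 0)
    (h₁ : ∀ i, M i i = 1) (i j : Fin n) : entry (ofMatrix M h₀ h₁) i j = M i j := rfl

theorem entry_rootElt (α : PosRoot n) (d : F) {i j : Fin n} (hij : i ≠ j) :
    entry (rootElt α d) i j = if α.row = i ∧ α.col = j then d else 0 := by
  change Matrix.transvection α.row α.col d i j = _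
  simp [Matrix.transvection, Matrix.single, hij]

theorem entry_rootElt_mul_of_ne (α : PosRoot n) (d : F) (u : unitri n F) {i : Fin n}
    (hi : i ≠ α.row) (j : Fin n) : entry (rootElt α d * u) i j = entry u i j :=
  Matrix.transvection_mul_apply_of_ne _ _ _ _ hi _ _

theorem entry_rootElt_mul_row (α : PosRoot n) (d : F) (u : unitri n F) (j : Fin n) :
    entry (rootElt α d * u) α.row j = entry u α.row j + d * entry u α.col j :=
  Matrix.transvection_mul_apply_same _ _ _ _ _

/-- Row elimination from the bottom, by induction on the number of nonzero entries above the
diagonal. No closure property of `S` is needed, since each step clears one entry and alters no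
other. -/
theorem mem_iSup_rootSubgroup (S : Set (PosRoot n)) (u : unitri n F)
    (hu : ∀ β : PosRoot n, entry u β.row β.col ≠ 0 → β ∈ S) :
    u ∈ ⨆ β ∈ S, rootSubgroup F β := by
  classical
  induction hN : (Finset.univ.filter fun p : Fin n × Fin n =>
    p.1 < p.2 ∧ entry u p.1 p.2 ≠ 0).card using Nat.strong_induction_on generalizing u with
  | _ N ih =>
  set T := Finset.univ.filter fun p : Fin n × Fin n => p.1 < p.2 ∧ entry u p.1 p.2 ≠ 0 with hT
  by_cases hTe : T = ∅
  · have : u = 1 := unitri_ext fun i j hij => by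
      rw [entry_one hij.ne]
      by_contra hne
      have : (i, j) ∈ T := by simp [hT, hij, hne]
      simp [hTe] at this
    rw [this]
    exact one_mem _
  · obtain ⟨⟨i, k⟩, hp, hmax⟩ := T.exists_max_image (fun p => p.1)
      (Finset.nonempty_iff_ne_empty.2 hTe)
    obtain ⟨hik, hne⟩ : i < k ∧ entry u i k ≠ 0 := by simpa [hT] using hp
    -- Row `i` is the lowest nontrivial row and `k > i`, so row `k` is that of the identity;
    -- subtracting a multiple of it from row `i` changes only the entry `(i, k)`.
    have hrow : ∀ j, k ≠ j → entry u k j = 0 := fun j hj => by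
      rcases lt_or_gt_of_ne hj with h | h
      · by_contra h0
        have := hmax (k, j) (by simp [hT, h, h0])
        exact absurd hik (not_lt.2 this)
      · exact entry_of_lt u h
    let β : PosRoot n := ⟨i, k, hik⟩
    have hβ : β ∈ S := hu β hne
    have hX : ∀ d, rootElt β d ∈ ⨆ β ∈ S, rootSubgroup F β := fun d =>
      (le_iSup₂_of_le (f := fun β (_ : β ∈ S) => rootSubgroup F β) β hβ le_rfl) ⟨d, rfl⟩
    set u' := rootElt β (-entry u i k) * u with hu'
    have h1 : entry u' i k = 0 := by
      have := entry_rootElt_mul_row β (-entry u i k) u k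
      change entry u' i k = entry u i k + -entry u i k * entry u k k at this
      rw [this, entry_self]
      ring
    have h2 : ∀ a b, ¬ (a = i ∧ b = k) → entry u' a b = entry u a b := by
      intro a b hab
      by_cases ha : a = i
      · subst ha
        have := entry_rootElt_mul_row β (-entry u a k) u b
        change entry u' a b = entry u a b + -entry u a k * entry u k b at this
        rw [this, hrow b fun hb => hab ⟨rfl, hb.symm⟩, mul_zero, add_zero]
      · exact entry_rootElt_mul_of_ne β _ u ha b
    have hmem : u' ∈ ⨆ β ∈ S, rootSubgroup F β := by
      refine ih _ ?_ u' (fun γ hγ => hu γ ?_) rfl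
      · rw [← hN]
        refine Finset.card_lt_card (Finset.ssubset_iff_subset_ne.2 ⟨fun p hp' => ?_, fun he => ?_⟩)
        · simp only [Finset.mem_filter, Finset.mem_univ, true_and] at hp'
          by_cases hpk : p.1 = i ∧ p.2 = k
          · rw [hpk.1, hpk.2] at hp'
            exact absurd h1 hp'.2
          · rw [h2 _ _ hpk] at hp'
            simpa [hT] using hp'
        · rw [← he] at hp
          simp [h1] at hp
      · by_cases hpk : γ.row = i ∧ γ.col = k
        · rw [hpk.1, hpk.2] at hγ
          exact absurd h1 hγ
        · rwa [h2 _ _ hpk] at hγ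
    rwa [hu', Subgroup.mul_mem_cancel_left _ (hX _)] at hmem

theorem mem_baseGroup_iff (α : PosRoot n) (u : unitri n F) :
    u ∈ baseGroup F α ↔ ∀ k, α.row < k → k < α.col → entry u α.row k = 0 := by
  constructor
  · let K : Subgroup (unitri n F) :=
      { carrier := {u | ∀ k, α.row < k → k < α.col → entry u α.row k = 0}
        one_mem' := fun k h _ => entry_one h.ne
        mul_mem' := fun {a b} ha hb k h h' => by
          rw [entry_mul_of_forall a b h fun m hm hm' => ha m hm (hm'.trans h'), ha k h h',
            hb k h h', add_zero]
        inv_mem' := fun {a} ha k h h' => by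
          rw [entry_inv_of_forall a h fun m hm hm' => ha m hm (hm'.trans h'), ha k h h', neg_zero] }
    have : baseGroup F α ≤ K := by
      refine iSup₂_le fun β hβ => ?_
      rintro _ ⟨d, rfl⟩ k h h'
      rw [entry_rootElt β d h.ne, if_neg]
      rintro ⟨h1, h2⟩
      exact hβ ⟨h1, h2 ▸ h'⟩
    exact fun hu => this hu
  · intro h
    refine mem_iSup_rootSubgroup _ u fun β hβ => ?_
    rintro ⟨h1, h2⟩
    exact hβ (h1 ▸ h β.col (h1 ▸ β.lt) h2)

theorem rootSubgroup_le_baseGroup {α β : PosRoot n} (h : β ∉ α.arm) :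
    rootSubgroup F β ≤ baseGroup F α :=
  le_iSup₂_of_le (f := fun β (_ : β ∈ α.armᶜ) => rootSubgroup F β) β h le_rfl

/-- On `V_α` the entry at `α` is additive, because the arm entries vanish; so both sides are
multiplicative, and they agree on the root subgroups. -/
theorem baseChars_apply (φ : AddChar F ℂ) {α : PosRoot n} {lam : baseGroup F α →* ℂˣ}
    (hlam : lam ∈ baseChars φ α) :
    ∃ s : F, s ≠ 0 ∧ ∀ u : baseGroup F α, (lam u : ℂ) = φ (s * entry u.1 α.row α.col) := by
  obtain ⟨s, hs, h1, h2⟩ := hlam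
  refine ⟨s, hs, ?_⟩
  suffices ∀ u ∈ ⨆ β : {β // β ∈ α.armᶜ}, rootSubgroup F β.1,
      ∃ h : u ∈ baseGroup F α, (lam ⟨u, h⟩ : ℂ) = φ (s * entry u α.row α.col) by
    rintro ⟨u, hu⟩
    obtain ⟨_, h⟩ := this u (by rw [iSup_subtype]; exact hu)
    exact h
  intro u hu
  refine Subgroup.iSup_induction _ (C := fun u => ∃ h : u ∈ baseGroup F α,
    (lam ⟨u, h⟩ : ℂ) = φ (s * entry u α.row α.col)) hu ?_ ?_ ?_
  · rintro ⟨β, hβ⟩ _ ⟨d, rfl⟩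
    have hle := rootSubgroup_le_baseGroup (F := F) hβ
    refine ⟨hle ⟨d, rfl⟩, ?_⟩
    rw [entry_rootElt β d α.lt.ne]
    by_cases hβα : β = α
    · subst hβα
      rw [h1, if_pos ⟨rfl, rfl⟩, mul_comm]
    · rw [h2 β hβα hle, if_neg fun h => hβα (PosRoot.ext h.1 h.2), mul_zero, φ.map_zero_eq_one,
        Units.val_one]
  · refine ⟨one_mem _, ?_⟩
    rw [entry_one α.lt.ne, mul_zero, φ.map_zero_eq_one]
    exact congrArg Units.val (map_one lam)
  · rintro x y ⟨hx, ex⟩ ⟨hy, ey⟩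
    refine ⟨mul_mem hx hy, ?_⟩
    rw [entry_mul_of_forall x y α.lt ((mem_baseGroup_iff α x).1 hx), mul_add, φ.map_add_eq_mul,
      ← ex, ← ey, ← Units.val_mul, ← map_mul]
    rfl

end Unitriangular

/-! ### Basic sets: product formula and intertwiners of `λ_D` -/

section BasicSets

variable {n : ℕ} {F : Type*} [Field F]

theorem mem_VD_iff (D : Finset (PosRoot n)) (u : unitri n F) :
    u ∈ VD F D ↔ ∀ α ∈ D, ∀ k, α.row < k → k < α.col → entry u α.row k = 0 := by
  simp only [VD, Subgroup.mem_iInf, Subtype.forall, mem_baseGroup_iff]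

theorem lamD_apply (φ : AddChar F ℂ) (D : Finset (PosRoot n))
    (lam : (α : D) → (baseGroup F α.1 →* ℂˣ)) (s : D → F)
    (hs : ∀ (α : D) (u : baseGroup F α.1), (lam α u : ℂ) = φ (s α * entry u.1 α.1.row α.1.col))
    (u : VD F D) :
    (lamD D lam u : ℂ) = ∏ α : D, φ (s α * entry u.1 α.1.row α.1.col) := by
  rw [lamD, MonoidHom.finsetProd_apply, Units.coe_prod]
  exact Finset.prod_congr rfl fun α _ => hs α _

/-- An element outside `V_D` is outside some `V_α`, so one factor on the right vanishes as well. -/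
theorem extendZero_lamD (D : Finset (PosRoot n)) (lam : (α : D) → (baseGroup F α.1 →* ℂˣ))
    (z : unitri n F) :
    extendZero (VD F D).subtype (linChar (lamD D lam)) z =
      ∏ α : D, extendZero (baseGroup F α.1).subtype (linChar (lam α)) z := by
  by_cases hz : z ∈ VD F D
  · have h1 := extendZero_apply (VD F D).subtype (VD F D).subtype_injective
      (linChar (lamD D lam)) ⟨z, hz⟩
    rw [Subgroup.subtype_apply] at h1
    rw [h1, linChar, lamD, MonoidHom.finsetProd_apply, Units.coe_prod]
    refine Finset.prod_congr rfl fun α _ => ?_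
    exact (extendZero_apply _ (baseGroup F α.1).subtype_injective (linChar (lam α))
      ⟨z, iInf_le (fun α : D => baseGroup F α.1) α hz⟩).symm
  · rw [extendZero_of_notMem_range _ _ (by simpa using hz)]
    rw [VD, Subgroup.mem_iInf, not_forall] at hz
    obtain ⟨α, hα⟩ := hz
    exact (Finset.prod_eq_zero (Finset.mem_univ α)
      (extendZero_of_notMem_range (baseGroup F α.1).subtype (linChar (lam α))
        (by simpa using hα))).symm

theorem linChar_conj {G : Type*} [Group G] (lam : G →* ℂˣ) (x g : G) :
    linChar lam (x * g * x⁻¹) = linChar lam g := by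
  rw [linChar, linChar, map_mul, map_mul, map_inv, mul_inv_cancel_comm]

/-- Cosets of the groups `V_α`, `α ∈ D`, have a common representative. -/
theorem exists_mk_eq (D : Finset (PosRoot n)) (hD : IsBasic D) (t : D → unitri n F) :
    ∃ x : unitri n F, ∀ α : D, x⁻¹ * t α ∈ baseGroup F α.1 := by
  classical
  -- `M` is to be `x⁻¹`: its row at `α` is copied from `(t α)⁻¹`, which makes that row of `x⁻¹ * t
  -- α` a row of the identity. Rows off `D` are those of the identity.
  let M : Matrix (Fin n) (Fin n) F := fun a b =>
    if h : ∃ α : D, α.1.row = a then entry (t h.choose)⁻¹ a b else (1 : Matrix _ _ F) a b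
  have h₀ : ∀ i j, j < i → M i j = 0 := fun i j hij => by
    by_cases h : ∃ α : D, α.1.row = i
    · simp only [M, dif_pos h, entry_of_lt _ hij]
    · simp only [M, dif_neg h, Matrix.one_apply_ne hij.ne']
  have h₁ : ∀ i, M i i = 1 := fun i => by
    by_cases h : ∃ α : D, α.1.row = i
    · simp only [M, dif_pos h, entry_self]
    · simp only [M, dif_neg h, Matrix.one_apply_eq]
  refine ⟨(ofMatrix M h₀ h₁)⁻¹, fun α => (mem_baseGroup_iff _ _).2 fun k hk _ => ?_⟩
  have hrow : ∀ b, M α.1.row b = entry (t α)⁻¹ α.1.row b := fun b => by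
    have h : ∃ β : D, β.1.row = α.1.row := ⟨α, rfl⟩
    have hc : h.choose = α := by
      by_contra hne
      exact (hD.2 _ h.choose.2 _ α.2 fun e => hne (Subtype.ext e)).1 h.choose_spec
    simp only [M, dif_pos h, hc]
  rw [inv_inv, entry_mul]
  simp_rw [entry_ofMatrix, hrow]
  rw [← entry_mul, inv_mul_cancel, entry_one hk.ne]

theorem superchar_eq_induced_lamD [Finite F] (D : Finset (PosRoot n)) (hD : IsBasic D)
    (lam : (α : D) → (baseGroup F α.1 →* ℂˣ)) :
    superchar D lam = induced (VD F D).subtype (linChar (lamD D lam)) := by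
  classical
  have := Fintype.ofFinite (unitri n F ⧸ VD F D)
  have : ∀ α : D, Fintype (unitri n F ⧸ baseGroup F α.1) := fun α => Fintype.ofFinite _
  ext g
  rw [superchar, Finset.prod_apply, induced_subtype_apply _ _ (linChar_conj _)]
  simp_rw [fun α : D => induced_subtype_apply (baseGroup F α.1) _ (linChar_conj (lam α)) g]
  rw [Finset.prod_univ_sum, Fintype.piFinset_univ]
  have hle : ∀ α : D, VD F D ≤ baseGroup F α.1 := iInf_le fun α : D => baseGroup F α.1
  -- Injectivity is the definition of `V_D` as an intersection; surjectivity is the common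
  -- representative, and is where the distinct rows of `D` enter.
  have hb : Function.Bijective fun (c : unitri n F ⧸ VD F D) (α : D) =>
      (c.out : unitri n F ⧸ baseGroup F α.1) := by
    constructor
    · intro c c' h
      rw [← QuotientGroup.out_eq' c, ← QuotientGroup.out_eq' c', QuotientGroup.eq]
      exact Subgroup.mem_iInf.2 fun α => QuotientGroup.eq.1 (congrFun h α)
    · intro t
      obtain ⟨x, hx⟩ := exists_mk_eq D hD fun α => (t α).out
      refine ⟨(x : unitri n F ⧸ VD F D), funext fun α => ?_⟩
      rw [← QuotientGroup.out_eq' (t α), ← QuotientGroup.eq.2 (hx α)]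
      exact QuotientGroup.eq.2 (hle α (QuotientGroup.eq.1 (QuotientGroup.out_eq' _)))
  symm
  refine Fintype.sum_bijective _ hb _ _ fun c => ?_
  rw [extendZero_lamD]
  refine Finset.prod_congr rfl fun α _ => ?_
  have hm : c.out⁻¹ * (c.out : unitri n F ⧸ baseGroup F α.1).out ∈ baseGroup F α.1 := by
    rw [← QuotientGroup.eq, QuotientGroup.out_eq']
  rw [← extendZero_subtype_conj _ _ (linChar_conj _) _ hm]
  congr 1
  group

theorem mem_GammaD {D : Finset (PosRoot n)} {τ σ γ : PosRoot n} (hτ : τ ∈ D) (hσ : σ ∈ D)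
    (hrow : γ.row = τ.row) (hcol : γ.col = σ.row) (h : τ.col < σ.col) : γ ∈ GammaD D := by
  have h1 : τ.row < σ.row := hrow ▸ hcol ▸ γ.lt
  refine ⟨τ, hτ, σ, hσ, h, h1, hrow, ⟨τ.row, σ.col, h1.trans σ.lt⟩, ?_⟩
  simp only [PosRoot.vec, hrow, hcol]
  abel

/-- A root in no arm has its root subgroup in every `V_α`, hence in `V_D`; a root of `Γ_D` has it in
`R_D`. -/
theorem mem_VRD (D : Finset (PosRoot n)) (x : unitri n F)
    (hx : ∀ β : PosRoot n, entry x β.row β.col ≠ 0 → (∃ τ ∈ D, β ∈ τ.arm) → β ∈ GammaD D) :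
    x ∈ VRD F D := by
  have hle : ⨆ β ∈ {β : PosRoot n | (∃ τ ∈ D, β ∈ τ.arm) → β ∈ GammaD D}, rootSubgroup F β ≤
      VRD F D := by
    refine iSup₂_le fun β hβ => ?_
    by_cases h : ∃ τ ∈ D, β ∈ τ.arm
    · exact (le_iSup₂_of_le (f := fun β (_ : β ∈ GammaD D) => rootSubgroup F β) β (hβ h)
        le_rfl).trans le_sup_right
    · refine (le_iInf fun α => rootSubgroup_le_baseGroup fun hα => h ⟨α.1, α.2, hα⟩).trans
        (le_sup_left : VD F D ≤ VRD F D)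
  exact hle (mem_iSup_rootSubgroup _ x hx)

/-- Elements of `U` outside `⟨V_D, R_D⟩` do not intertwine `λ_D` with itself. -/
theorem exists_lamD_ne (φ : AddChar F ℂ) (hφ : φ ≠ 1) (D : Finset (PosRoot n)) (hD : IsBasic D)
    (lam : (α : D) → (baseGroup F α.1 →* ℂˣ)) (hlam : lam ∈ basicData φ D) (x : unitri n F)
    (hx : x ∉ VRD F D) :
    ∃ v w : VD F D, x * v = w * x ∧ lamD D lam v ≠ lamD D lam w := by
  classical
  choose s hs0 hs using fun α : D => baseChars_apply φ (hlam α)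
  obtain ⟨β, hβ, ⟨τ, hτ, hβτ⟩, hΓ⟩ : ∃ β : PosRoot n, entry x β.row β.col ≠ 0 ∧
      (∃ τ ∈ D, β ∈ τ.arm) ∧ β ∉ GammaD D := by
    by_contra hcon
    push Not at hcon
    exact hx (mem_VRD D x hcon)
  set k := β.col with hk
  -- Among the arms that meet column `k` in a nonzero entry of `x`, take the one whose root is
  -- furthest right. Maximality will put `w` in `V_D`.
  obtain ⟨τ₀, hτ₀, hmax⟩ := (D.filter fun α => α.row < k ∧ k < α.col ∧
    entry x α.row k ≠ 0).exists_max_image PosRoot.col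
      ⟨τ, Finset.mem_filter.2 ⟨hτ, hβτ.1 ▸ β.lt, hβτ.2, hβτ.1 ▸ hβ⟩⟩
  obtain ⟨hτ₀D, hik, hkj, hne⟩ := Finset.mem_filter.1 hτ₀
  have hτle : τ.col ≤ τ₀.col :=
    hmax τ (Finset.mem_filter.2 ⟨hτ, hβτ.1 ▸ β.lt, hβτ.2, hβτ.1 ▸ hβ⟩)
  set j := τ₀.col with hj
  have hbig : ∀ α ∈ D, α.row < k → j < α.col → entry x α.row k = 0 := by
    intro α hα h1 h2
    by_contra h0
    exact absurd h2 (not_lt.2 (hmax α (Finset.mem_filter.2 ⟨hα, h1, hkj.trans h2, h0⟩)))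
  -- A root `σ` of `D` on row `k` strictly to the right of `τ` would put `β` in `Γ_D`, and equal
  -- columns are excluded in a basic set. This will put `v` in `V_D` and in the kernel of `λ_D`.
  have hsmall : ∀ σ ∈ D, σ.row = k → σ.col < j := by
    intro σ hσ hσk
    refine lt_of_lt_of_le (lt_of_le_of_ne (not_lt.1 fun h => hΓ ?_) ?_) hτle
    · exact mem_GammaD hτ hσ hβτ.1 hσk.symm h
    · refine (hD.2 σ hσ τ hτ ?_).2
      rintro rfl
      exact absurd β.lt (by rw [hβτ.1, hσk]; exact lt_irrefl _)
  obtain ⟨d₀, hd₀⟩ : ∃ d, φ d ≠ 1 := by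
    by_contra hcon
    push Not at hcon
    exact hφ (DFunLike.ext _ _ hcon)
  -- Chosen so that `λ_D(w) = φ(d₀)`.
  set d : F := d₀ / (s ⟨τ₀, hτ₀D⟩ * entry x τ₀.row k) with hd
  have hsd : s ⟨τ₀, hτ₀D⟩ * (entry x τ₀.row k * d) = d₀ := by
    rw [hd, ← mul_assoc, mul_div_cancel₀ _ (mul_ne_zero (hs0 _) hne)]
  set X : Matrix (Fin n) (Fin n) F := ((x : GL (Fin n) F) : Matrix (Fin n) (Fin n) F) with hX
  have hl : ∀ a b, (Matrix.single k j d * X) a b = if a = k then d * entry x j b else 0 := by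
    intro a b
    split_ifs with h
    · subst h
      exact Matrix.single_mul_apply_same _ _ _ _ _
    · exact Matrix.single_mul_apply_of_ne _ _ _ _ _ h _
  have hr : ∀ a b, (X * Matrix.single k j d) a b = if b = j then entry x a k * d else 0 := by
    intro a b
    split_ifs with h
    · rw [h]
      exact Matrix.mul_single_apply_same _ _ _ _ _
    · exact Matrix.mul_single_apply_of_ne _ _ _ _ _ h _
  have hl0 : ∀ a b, b ≤ a → (Matrix.single k j d * X) a b = 0 := by
    intro a b hab
    rw [hl]
    split_ifs with h
    · rw [entry_of_lt x (lt_of_le_of_lt hab (h ▸ hkj)), mul_zero]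
    · rfl
  have hr0 : ∀ a b, b ≤ a → (X * Matrix.single k j d) a b = 0 := by
    intro a b hab
    rw [hr]
    split_ifs with h
    · rw [entry_of_lt x (hkj.trans_le (h ▸ hab)), zero_mul]
    · rfl
  -- Off the diagonal `v` lives on row `k`, from column `j` onwards, and `w` on column `j`, down to
  -- row `k`.
  let v : unitri n F := ofMatrix (1 + Matrix.single k j d * X)
    (fun a b hab => by rw [Matrix.add_apply, hl0 _ _ hab.le, Matrix.one_apply_ne hab.ne', add_zero])
    (fun a => by rw [Matrix.add_apply, hl0 _ _ le_rfl, Matrix.one_apply_eq, add_zero])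
  let w : unitri n F := ofMatrix (1 + X * Matrix.single k j d)
    (fun a b hab => by rw [Matrix.add_apply, hr0 _ _ hab.le, Matrix.one_apply_ne hab.ne', add_zero])
    (fun a => by rw [Matrix.add_apply, hr0 _ _ le_rfl, Matrix.one_apply_eq, add_zero])
  have hv : ∀ {a b : Fin n}, a ≠ b → entry v a b = if a = k then d * entry x j b else 0 :=
    fun {a b} hab => by
      rw [← hl, entry_ofMatrix, Matrix.add_apply, Matrix.one_apply_ne hab, zero_add]
  have hw : ∀ {a b : Fin n}, a ≠ b → entry w a b = if b = j then entry x a k * d else 0 :=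
    fun {a b} hab => by
      rw [← hr, entry_ofMatrix, Matrix.add_apply, Matrix.one_apply_ne hab, zero_add]
  have hvD : v ∈ VD F D := (mem_VD_iff D v).2 fun α hα b h1 h2 => by
    rw [hv h1.ne]
    split_ifs with h
    · rw [entry_of_lt x (h2.trans (hsmall α hα h)), mul_zero]
    · rfl
  have hwD : w ∈ VD F D := (mem_VD_iff D w).2 fun α hα b h1 h2 => by
    rw [hw h1.ne]
    split_ifs with h
    · rw [h] at h2
      rcases lt_trichotomy α.row k with h3 | h3 | h3
      · rw [hbig α hα h3 h2, zero_mul]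
      · exact absurd h2 (hsmall α hα h3).asymm
      · rw [entry_of_lt x h3, zero_mul]
    · rfl
  refine ⟨⟨v, hvD⟩, ⟨w, hwD⟩, ?_, fun he => hd₀ ?_⟩
  · refine Subtype.ext (Units.ext ?_)
    change X * (1 + Matrix.single k j d * X) = (1 + X * Matrix.single k j d) * X
    rw [mul_add, add_mul, mul_one, one_mul, mul_assoc]
  · have h1 : (lamD D lam ⟨v, hvD⟩ : ℂ) = 1 := by
      rw [lamD_apply φ D lam s hs]
      refine Finset.prod_eq_one fun α _ => ?_
      rw [hv α.1.lt.ne]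
      split_ifs with h
      · rw [entry_of_lt x (hsmall α.1 α.2 h), mul_zero, mul_zero, φ.map_zero_eq_one]
      · rw [mul_zero, φ.map_zero_eq_one]
    -- Only `τ₀` contributes, being the one root of `D` in column `j`.
    have h2 : (lamD D lam ⟨w, hwD⟩ : ℂ) = φ d₀ := by
      rw [lamD_apply φ D lam s hs, Finset.prod_eq_single (⟨τ₀, hτ₀D⟩ : D)]
      · rw [hw τ₀.lt.ne, if_pos rfl, hsd]
      · intro α _ hα
        rw [hw α.1.lt.ne, if_neg, mul_zero, φ.map_zero_eq_one]
        exact (hD.2 α.1 α.2 τ₀ hτ₀D fun e => hα (Subtype.ext e)).2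
      · exact fun h => absurd (Finset.mem_univ _) h
    rw [← h2, ← he, h1]

end BasicSets

end SuperChar

/-! ### The theorem -/

theorem mainTheorem1 {n : ℕ} {F : Type*} [Field F] [Finite F]
    (φ : AddChar F ℂ) (hφ : φ ≠ 1)
    (D : Finset (SuperChar.PosRoot n)) (hD : SuperChar.IsBasic D)
    (lam : (α : D) → (SuperChar.baseGroup F α.1 →* ℂˣ))
    (hlam : lam ∈ SuperChar.basicData φ D) :
    (SuperChar.superchar D lam =
        SuperChar.induced (SuperChar.VD F D).subtype
          (SuperChar.linChar (SuperChar.lamD D lam)) ∧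
      SuperChar.superchar D lam =
        SuperChar.induced (SuperChar.VRD F D).subtype (SuperChar.lamDVRD D lam)) ∧
    (∀ χ ∈ SuperChar.constituents (SuperChar.lamDVRD D lam),
      SuperChar.induced (SuperChar.VRD F D).subtype χ ∈
        SuperChar.constituents (SuperChar.superchar D lam)) ∧
    (∀ χ₁ ∈ SuperChar.constituents (SuperChar.lamDVRD D lam),
      ∀ χ₂ ∈ SuperChar.constituents (SuperChar.lamDVRD D lam), χ₁ ≠ χ₂ →
        SuperChar.induced (SuperChar.VRD F D).subtype χ₁ ≠
          SuperChar.induced (SuperChar.VRD F D).subtype χ₂) := by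
  have h1 := SuperChar.superchar_eq_induced_lamD D hD lam
  have := Fintype.ofFinite (SuperChar.unitri n F)
  have h2 : SuperChar.superchar D lam =
      SuperChar.induced (SuperChar.VRD F D).subtype (SuperChar.lamDVRD D lam) := by
    rw [h1, SuperChar.lamDVRD,
      SuperChar.induced_induced _ _ (SuperChar.VRD F D).subtype_injective]
    -- The inclusion of `V_D` in `⟨V_D, R_D⟩` followed by that into `U` is the inclusion of `V_D` in
    -- `U` by definition.
    rfl
  have hi : Function.Injective
      (Subgroup.inclusion (le_sup_left : SuperChar.VD F D ≤ SuperChar.VRD F D)) :=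
    Subgroup.inclusion_injective _
  have hint := SuperChar.exists_lamD_ne φ hφ D hD lam hlam
  refine ⟨⟨h1, h2⟩, fun χ hχ => ?_, fun χ₁ hχ₁ χ₂ hχ₂ hne => ?_⟩
  · rw [h2]
    exact SuperChar.induced_mem_constituents _ _ hi _ hint hχ
  · exact SuperChar.induced_ne_induced _ _ hi _ hint hχ₁ hχ₂ hne

end
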